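/- SK-combinators are the terms built from the two primitive combinators $\mathbf{S}$ and $\mathbf{K}$ by binary application; the size of a combinator is its number of applications (so $\mathbf{S}$ and $\mathbf{K}$ have size $0$). Reduction is the closure under application on either side of the rules $\mathbf{K}\,x\,y \to x$ and $\mathbf{S}\,x\,y\,z \to x\,z\,(y\,z)$; a combinator that does not reduce is a normal form, and a normal-order step contracts the leftmost outermost redex. Let $C(z)=\sum_n c_n z^n$ be the ordinary generating function of all SK-combinators, $c_n$ being the number of those of size $n$. For $k \ge 1$ let $R_k(z)$ be the ordinary generating function of the SK-combinators that reach normal form in exactly $k$ normal-order reduction steps. Write $a_n \sim b_n$ if $a_n/b_n \to 1$ as $n\to\infty$. **Theorem.** One has $$[z^n]C(z) \sim 8^n\,\frac{(-4)\, n^{-3/2}}{\Gamma(-1/2)},$$ and for each $k \ge 1$ there is a constant $\overline{C}_k < 0$, depending only on $k$, such that $$[z^n]R_k(z) \sim 8^n\,\frac{\overline{C}_k\, n^{-3/2}}{\Gamma(-1/2)}.$$ Consequently, for each $k \ge 1$ the set of SK-combinators that reach normal form in exactly $k$ normal-order steps has an asymptotic density in the set of all SK-combinators, equal to $\overline{C}_k/(-4)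 > 0$: that is, $$\lim_{n\to\infty} \frac{[z^n]R_k(z)}{[z^n]C(z)} = \frac{\overline{C}_k}{-4}.$$ -/

import Mathlib

open Asymptotics Filter Topology

/-- `SK`-combinators: the two primitive combinators, closed under application. -/
inductive SK : Type
  | S : SK
  | K : SK
  | app : SK → SK → SK

namespace SK

/-- The size of a combinator: its number of applications
(inner nodes of the corresponding plane binary tree). -/
def size : SK → ℕ
  | S => 0
  | K => 0
  | app M N => size M + size N + 1

/-- The reduction rules `K x y → x` and `S x y z → x z (y z)`, at the root of the term. -/
inductive Contracts : SK → SK → Prop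
  | k (x y : SK) : Contracts (app (app K x) y) x
  | s (x y z : SK) : Contracts (app (app (app S x) y) z) (app (app x z) (app y z))

/-- The reduction relation: the closure of the rules under application on either side. -/
inductive Reduces : SK → SK → Prop
  | root {P Q : SK} : Contracts P Q → Reduces P Q
  | left {P Q : SK} (R : SK) : Reduces P Q → Reduces (app P R) (app Q R)
  | right {P Q : SK} (R : SK) : Reduces P Q → Reduces (app R P) (app R Q)

/-- A normal form is a combinator that does not reduce to anything. -/
def NormalForm (P : SK) : Prop := ¬ ∃ Q, Reduces P Q

/-- `P` is itself a redex (at its root). -/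
def IsRedex (P : SK) : Prop := ∃ Q, Contracts P Q

/-- One normal-order step: the leftmost outermost redex is contracted. A term that is a redex is
contracted at the root; in any other application the step is made in the function part, and in the
argument only if the function part contains no redex. -/
inductive NormalOrderStep : SK → SK → Prop
  | root {P Q : SK} : Contracts P Q → NormalOrderStep P Q
  | left {P Q : SK} (R : SK) : ¬ IsRedex (app P R) → NormalOrderStep P Q →
      NormalOrderStep (app P R) (app Q R)
  | right {P Q : SK} (R : SK) : ¬ IsRedex (app R P) → NormalForm R → NormalOrderStep P Q →
      NormalOrderStep (app R P) (app R Q)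

/-- `NormalizesIn k P`: the normal-order reduction of `P` reaches a normal form in exactly `k`
steps. -/
def NormalizesIn : ℕ → SK → Prop
  | 0, P => NormalForm P
  | k + 1, P => ∃ Q, NormalOrderStep P Q ∧ NormalizesIn k Q

/-- The class `R k` of combinators that reach normal form in exactly `k` normal-order steps. -/
def R (k : ℕ) : Set SK := {P | NormalizesIn k P}

/-- The number of elements of size `n` in a class of combinators. -/
noncomputable def count (A : Set SK) (n : ℕ) : ℕ := {P | P ∈ A ∧ size P = n}.ncard

/-- There are only finitely many combinators of bounded size. -/
theorem finite_size_lt (n : ℕ) : {P : SK | size P < n}.Finite := by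
  induction n with
  | zero => simp
  | succ n ih =>
    refine (((Set.finite_singleton K).insert S).union (Set.Finite.image2 app ih ih)).subset ?_
    intro P hP
    cases P with
    | S => simp
    | K => simp
    | app M N =>
      simp only [size, Set.mem_ofPred_eq] at hP
      refine Or.inr ⟨M, ?_, N, ?_, rfl⟩ <;> simp only [Set.mem_ofPred_eq] <;> omega

/-- The sets counted by `count` are finite, so that `count` is the true cardinality. -/
theorem finite_count (A : Set SK) (n : ℕ) : {P | P ∈ A ∧ size P = n}.Finite :=
  (finite_size_lt (n + 1)).subset fun P hP => by
    have := hP.2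
    simp only [Set.mem_ofPred_eq]
    omega

/-- The ordinary generating function of a class of combinators. -/
noncomputable def genFun (A : Set SK) : PowerSeries ℝ := PowerSeries.mk fun n => (count A n : ℝ)

/-- The class `A` has asymptotic density `d` in the class of all combinators. -/
def HasDensity (A : Set SK) (d : ℝ) : Prop :=
  Tendsto (fun n : ℕ => (count A n : ℝ) / (count Set.univ n : ℝ)) atTop (𝓝 d)

end SK

/-!
The generating function plays no role beyond its coefficients: the argument is about
large random terms, and uses only elementary estimates.

The number of terms is `c_n = 2 ^ (n + 1) * catalan n`, so the asymptotics of `c_n` is Wallis'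
formula. It gives `c_n / c_{n + 1} → 1 / 8` and `∑ c_i 8^{-(i + 1)} = 1 / 2`. Hence a large random
term `M N` has, up to small probability, one small part: the function part is a given term `M`
with probability tending to `8^{-(|M| + 1)}`, the argument is then large and uniformly distributed,
and symmetrically with `M` and `N` exchanged (`SK.nearLim_ratio_of_sections`).

Whether a term normalizes in `k` normal-order steps only depends on the part of it that is not
below `k + 1` nested redexes. This is made precise by the relation `SK.Agree j` with a budget of `j`
redexes on each branch: one normal-order step costs one unit of the budget
(`SK.Agree.exists_step`), and a normal form agrees only with itself as long as the budget is
positive. So the class `R k` is closed under `Agree (k + 1)` (`SK.saturated_R`).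

Every class `A` closed under `Agree j` has a density (`SK.Saturated.exists_tendsto_ratio`), by
induction on `j`. The classes `{N | M N ∈ A}` and `{M | M N ∈ A}` are again closed under `Agree j`,
and for `M = K x` the class `{N | K x N ∈ A}` is even closed under `Agree (j - 1)`, because its
elements sit below a redex; so it has a density. As the probabilities of all small parts add up to
one and `M = K S` has positive probability, the oscillation of the proportion of `A` is at most a
fixed multiple, less than one, of a bound common to all classes closed under `Agree j`. Iterating,
the oscillation is zero.

The density of `R k` is positive for `k ≥ 1` because `R k` contains the terms
`K (… (K (K S P) S) …) S` for all `P`.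
-/

namespace SK

/-! ### Normalization looks at finitely many redexes on each branch -/

/-- `Agree j P P'`: the terms `P` and `P'` coincide except possibly strictly below `j` nested
redexes. Going from a term to its subterms, the budget `j` drops by one at each redex, whose head
`K` or `S` has to be the same in both terms; once the budget is used up, anything is allowed. -/
inductive Agree : ℕ → SK → SK → Prop
  | any (P P' : SK) : Agree 0 P P'
  | leafS (j : ℕ) : Agree j S S
  | leafK (j : ℕ) : Agree j K K
  | node {j : ℕ} {M M' N N' : SK} : ¬ IsRedex (app M N) → Agree (j + 1) M M' →
      Agree (j + 1) N N' → Agree (j + 1) (app M N) (app M' N')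
  | redexK {j : ℕ} {x x' y y' : SK} : Agree j x x' → Agree j y y' →
      Agree (j + 1) (app (app K x) y) (app (app K x') y')
  | redexS {j : ℕ} {x x' y y' z z' : SK} : Agree j x x' → Agree j y y' → Agree j z z' →
      Agree (j + 1) (app (app (app S x) y) z) (app (app (app S x') y') z')

theorem isRedex_K (x y : SK) : IsRedex (app (app K x) y) := ⟨_, .k x y⟩

theorem isRedex_S (x y z : SK) : IsRedex (app (app (app S x) y) z) := ⟨_, .s x y z⟩

theorem Agree.pred {j : ℕ} {P P' : SK} (h : Agree j P P') : Agree (j - 1) P P' := by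
  induction h with
  | any P P' => exact .any _ _
  | leafS j => exact .leafS _
  | leafK j => exact .leafK _
  | @node j _ _ _ _ hr _ _ ihM ihN =>
    cases j with
    | zero => exact .any _ _
    | succ j => exact .node hr ihM ihN
  | @redexK j _ _ _ _ _ _ ihx ihy =>
    cases j with
    | zero => exact .any _ _
    | succ j => exact .redexK ihx ihy
  | @redexS j _ _ _ _ _ _ _ _ _ ihx ihy ihz =>
    cases j with
    | zero => exact .any _ _
    | succ j => exact .redexS ihx ihy ihz

theorem Agree.of_succ {j : ℕ} {P P' : SK} (h : Agree (j + 1) P P') : Agree j P P' := h.pred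

theorem Agree.congr {j : ℕ} {M M' N N' : SK} (hM : Agree j M M') (hN : Agree j N N') :
    Agree j (app M N) (app M' N') := by
  cases j with
  | zero => exact .any _ _
  | succ j =>
    by_cases hr : IsRedex (app M N)
    · obtain ⟨Q, hQ⟩ := hr
      cases hQ with
      | k x y =>
        cases hM with
        | node _ h1 h2 =>
          cases h1 with
          | leafK => exact .redexK h2.of_succ hN.of_succ
      | s x y z =>
        cases hM with
        | node _ h1 h2 =>
          cases h1 with
          | node _ h3 h4 =>
            cases h3 with
            | leafS => exact .redexS h4.of_succ h2.of_succ hN.of_succ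
    · exact .node hr hM hN

theorem Agree.refl (j : ℕ) (P : SK) : Agree j P P := by
  induction P with
  | S => exact .leafS _
  | K => exact .leafK _
  | app M N ihM ihN => exact ihM.congr ihN

/-- Terms that agree with a positive budget have their redexes at the same places near the root. -/
theorem Agree.isRedex_of_isRedex {j : ℕ} {M M' N N' : SK} (hM : Agree (j + 1) M M')
    (hr : IsRedex (app M' N')) : IsRedex (app M N) := by
  obtain ⟨Q, hQ⟩ := hr
  cases hQ with
  | k x y =>
    cases hM with
    | node _ h1 h2 =>
      cases h1 with
      | leafK => exact isRedex_K _ _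
  | s x y z =>
    cases hM with
    | node _ h1 h2 =>
      cases h1 with
      | node _ h3 h4 =>
        cases h3 with
        | leafS => exact isRedex_S _ _ _

theorem Agree.eq_of_normalForm {j : ℕ} {P P' : SK} (h : Agree (j + 1) P P') (hP : NormalForm P) :
    P' = P := by
  obtain ⟨i, hi⟩ : ∃ i, i = j + 1 := ⟨_, rfl⟩
  rw [← hi] at h
  induction h with
  | any P P' => omega
  | leafS j => rfl
  | leafK j => rfl
  | node hr _ _ ihM ihN =>
    rw [ihM (fun ⟨Q, hQ⟩ => hP ⟨_, .left _ hQ⟩) hi, ihN (fun ⟨Q, hQ⟩ => hP ⟨_, .right _ hQ⟩) hi]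
  | redexK => exact absurd ⟨_, .root (.k _ _)⟩ hP
  | redexS => exact absurd ⟨_, .root (.s _ _ _)⟩ hP

/-- A normal-order step costs one unit of the budget: contracting a redex merges the parts of the
term just below it with those above it, and these have budgets differing by one. -/
theorem Agree.exists_step {j : ℕ} {P P' Q : SK} (h : Agree (j + 1) P P')
    (hs : NormalOrderStep P Q) : ∃ Q', NormalOrderStep P' Q' ∧ Agree j Q Q' := by
  induction hs generalizing P' with
  | root hc =>
    cases hc with
    | k x y =>
      cases h with
      | node hr => exact absurd (isRedex_K _ _) hr
      | redexK hx hy => exact ⟨_, .root (.k _ _), hx⟩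
    | s x y z =>
      cases h with
      | node hr => exact absurd (isRedex_S _ _ _) hr
      | redexS hx hy hz => exact ⟨_, .root (.s _ _ _), (hx.congr hz).congr (hy.congr hz)⟩
  | left R hr _ ih =>
    cases h with
    | node _ hM hN =>
      obtain ⟨Q', hQ', hA⟩ := ih hM
      exact ⟨_, .left _ (fun h => hr (hM.isRedex_of_isRedex h)) hQ', hA.congr hN.of_succ⟩
    | redexK => exact absurd (isRedex_K _ _) hr
    | redexS => exact absurd (isRedex_S _ _ _) hr
  | right R hr hnf _ ih =>
    cases h with
    | node _ hM hN =>
      obtain ⟨Q', hQ', hA⟩ := ih hN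
      refine ⟨_, .right _ (fun h => hr (hM.isRedex_of_isRedex h)) ?_ hQ', hM.of_succ.congr hA⟩
      rwa [hM.eq_of_normalForm hnf]
    | redexK => exact absurd (isRedex_K _ _) hr
    | redexS => exact absurd (isRedex_S _ _ _) hr

theorem NormalizesIn.of_agree {k : ℕ} {P P' : SK} (hP : NormalizesIn k P)
    (h : Agree (k + 1) P P') : NormalizesIn k P' := by
  induction k generalizing P P' with
  | zero =>
    have hP : NormalForm P := hP
    rw [h.eq_of_normalForm hP]
    exact hP
  | succ k ih =>
    obtain ⟨Q, hQ, hk⟩ := hP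
    obtain ⟨Q', hQ', hA⟩ := h.exists_step hQ
    exact ⟨Q', hQ', ih hk hA⟩

/-- A class of terms is saturated at level `j` if it is closed under `Agree j`. -/
def Saturated (j : ℕ) (A : Set SK) : Prop := ∀ ⦃P P' : SK⦄, P ∈ A → Agree j P P' → P' ∈ A

/-- Normalizing in `k` steps is decided above the first `k + 1` nested redexes. -/
theorem saturated_R (k : ℕ) : Saturated (k + 1) (R k) := fun _ _ hP h => hP.of_agree h

theorem Saturated.eq_empty_or_univ {A : Set SK} (hA : Saturated 0 A) : A = ∅ ∨ A = Set.univ := by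
  rcases A.eq_empty_or_nonempty with h | ⟨P, hP⟩
  · exact .inl h
  · exact .inr (Set.eq_univ_of_forall fun P' => hA hP (.any _ _))

/-- The arguments `N` for which `M N` lies in `A`. -/
def argSection (A : Set SK) (M : SK) : Set SK := {N | app M N ∈ A}

/-- The functions `M` for which `M N` lies in `A`. -/
def funSection (A : Set SK) (N : SK) : Set SK := {M | app M N ∈ A}

theorem saturated_argSection {j : ℕ} {A : Set SK} (hA : Saturated j A) (M : SK) :
    Saturated j (argSection A M) :=
  fun _ _ hN h => hA hN ((Agree.refl j M).congr h)

theorem saturated_funSection {j : ℕ} {A : Set SK} (hA : Saturated j A) (N : SK) :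
    Saturated j (funSection A N) :=
  fun _ _ hM h => hA hM (h.congr (Agree.refl j N))

/-- The argument of `K x` sits below a redex, so its section gains a level of saturation. -/
theorem saturated_argSection_K {j : ℕ} {A : Set SK} (hA : Saturated (j + 1) A) (x : SK) :
    Saturated j (argSection A (app K x)) :=
  fun _ _ hN h => hA hN (.redexK (Agree.refl j x) h)

/-! ### Counting terms -/

/-- The finite set of all terms of size `n`. -/
noncomputable def ofSize (n : ℕ) : Finset SK := (finite_count Set.univ n).toFinset

@[simp] theorem mem_ofSize {n : ℕ} {P : SK} : P ∈ ofSize n ↔ size P = n := by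
  simp [ofSize]

theorem card_ofSize (n : ℕ) : (ofSize n).card = count Set.univ n :=
  (Set.ncard_eq_toFinset_card _ _).symm

theorem count_mono {A B : Set SK} (h : A ⊆ B) (n : ℕ) : count A n ≤ count B n :=
  Set.ncard_le_ncard (fun _ hP => ⟨h hP.1, hP.2⟩) (finite_count B n)

open Classical in
theorem count_eq_card_filter (A : Set SK) (n : ℕ) :
    count A n = ((ofSize n).filter (· ∈ A)).card := by
  rw [count, ← Set.ncard_coe_finset]
  congr 1
  ext P
  simp [and_comm]

open Classical in
/-- The number of terms `M N` in `A` with `M` of size `i` and `N` of size `l`. -/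
noncomputable def countSplit (A : Set SK) (i l : ℕ) : ℕ :=
  ((ofSize i ×ˢ ofSize l).filter fun p => app p.1 p.2 ∈ A).card

theorem countSplit_eq_sum_argSection (A : Set SK) (i l : ℕ) :
    countSplit A i l = ∑ M ∈ ofSize i, count (argSection A M) l := by
  classical
  simp only [countSplit, count_eq_card_filter, Finset.card_filter, Finset.sum_product]
  rfl

theorem countSplit_eq_sum_funSection (A : Set SK) (i l : ℕ) :
    countSplit A i l = ∑ N ∈ ofSize l, count (funSection A N) i := by
  classical
  simp only [countSplit, count_eq_card_filter, Finset.card_filter, Finset.sum_product_right]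
  rfl

theorem countSplit_univ (i l : ℕ) :
    countSplit Set.univ i l = count Set.univ i * count Set.univ l := by
  have h : ∀ M, argSection Set.univ M = Set.univ := fun _ => rfl
  simp [countSplit_eq_sum_argSection, h, card_ofSize]

theorem countSplit_le (A : Set SK) (i l : ℕ) : countSplit A i l ≤ countSplit Set.univ i l := by
  simp only [countSplit_eq_sum_argSection]
  exact Finset.sum_le_sum fun M _ => count_mono (fun _ _ => Set.mem_univ _) l

theorem count_succ (A : Set SK) (n : ℕ) :
    count A (n + 1) = ∑ i ∈ Finset.range (n + 1), countSplit A i (n - i) := by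
  classical
  rw [← Finset.Nat.sum_antidiagonal_eq_sum_range_succ (countSplit A)]
  simp only [countSplit]
  rw [← Finset.card_sigma, count_eq_card_filter]
  symm
  refine Finset.card_bij (fun p _ => app p.2.1 p.2.2) ?_ ?_ ?_
  · rintro ⟨⟨i, l⟩, M, N⟩ h
    simp only [Finset.mem_sigma, Finset.HasAntidiagonal.mem_antidiagonal, Finset.mem_filter, Finset.mem_product,
      mem_ofSize] at h ⊢
    exact ⟨by simp only [size]; omega, h.2.2⟩
  · rintro ⟨⟨i, l⟩, M, N⟩ h ⟨⟨i', l'⟩, M', N'⟩ h' e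
    simp only [Finset.mem_sigma, Finset.HasAntidiagonal.mem_antidiagonal, Finset.mem_filter, Finset.mem_product,
      mem_ofSize] at h h'
    cases e
    obtain ⟨-, ⟨rfl, rfl⟩, -⟩ := h
    obtain ⟨-, ⟨rfl, rfl⟩, -⟩ := h'
    rfl
  · intro P hP
    rw [Finset.mem_filter, mem_ofSize] at hP
    cases P with
    | S => simp [size] at hP
    | K => simp [size] at hP
    | app M N =>
      refine ⟨⟨(size M, size N), M, N⟩, ?_, rfl⟩
      simp only [Finset.mem_sigma, Finset.HasAntidiagonal.mem_antidiagonal, Finset.mem_filter, Finset.mem_product,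
        mem_ofSize, true_and]
      have := hP.1
      simp only [size] at this
      exact ⟨by omega, hP.2⟩

theorem count_univ_zero : count Set.univ 0 = 2 := by
  have : {P : SK | P ∈ Set.univ ∧ size P = 0} = {S, K} := by
    ext P
    cases P <;> simp [size]
  rw [count, this, Set.ncard_pair (by simp)]

theorem count_univ_eq_catalan (n : ℕ) : count Set.univ n = 2 ^ (n + 1) * catalan n := by
  induction n using Nat.strong_induction_on with
  | _ n ih =>
    cases n with
    | zero => simp [count_univ_zero]
    | succ n =>
      rw [count_succ, catalan_succ, Fin.sum_univ_eq_sum_range (fun i => catalan i * catalan (n - i)),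
        Finset.mul_sum]
      refine Finset.sum_congr rfl fun i hi => ?_
      have hi : i ≤ n := Nat.lt_succ_iff.mp (Finset.mem_range.mp hi)
      rw [countSplit_univ, ih i (by omega), ih (n - i) (by omega)]
      obtain ⟨l, rfl⟩ := Nat.exists_eq_add_of_le hi
      rw [Nat.add_sub_cancel_left]
      ring

theorem count_univ_pos (n : ℕ) : 0 < count Set.univ n := by
  rw [count_univ_eq_catalan]
  have := succ_mul_catalan_eq_centralBinom n
  have h := Nat.centralBinom_pos n
  have : 0 < catalan n := Nat.pos_of_ne_zero fun h0 => by simp [h0] at this; omega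
  positivity

/-! ### Asymptotics of the number of terms -/

theorem tendsto_centralBinom_mul_sqrt :
    Tendsto (fun n : ℕ => (n.centralBinom : ℝ) / 4 ^ n * √n) atTop (𝓝 (1 / √Real.pi)) := by
  have hW : ∀ n : ℕ, (n.centralBinom : ℝ) / 4 ^ n * √n
      = √((n : ℝ) / (2 * n + 1) / Real.Wallis.W n) := by
    intro n
    rw [eq_comm, Real.sqrt_eq_iff_mul_self_eq (by have := Real.Wallis.W_pos n; positivity)
      (by positivity), mul_mul_mul_comm, Real.mul_self_sqrt (Nat.cast_nonneg n),
      Real.Wallis.W_eq_factorial_ratio, Nat.centralBinom_eq_two_mul_choose,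
      Nat.cast_choose ℝ (by omega : n ≤ 2 * n), show 2 * n - n = n by omega]
    have h1 : (n.factorial : ℝ) ≠ 0 := by positivity
    have h2 : ((2 * n).factorial : ℝ) ≠ 0 := by positivity
    have h3 : (2 : ℝ) ^ (4 * n) = 4 ^ n * 4 ^ n := by
      rw [pow_mul, ← mul_pow]; norm_num
    rw [h3]
    field_simp
  simp only [hW]
  have h1 : Tendsto (fun n : ℕ => (n : ℝ) / (2 * n + 1)) atTop (𝓝 (1 / 2)) := by
    have h := tendsto_natCast_div_add_atTop (1 / 2 : ℝ)
    have := h.mul_const (1 / 2)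
    rw [one_mul] at this
    refine this.congr fun n => ?_
    field_simp
  have h2 := (h1.div Real.Wallis.tendsto_W_nhds_pi_div_two (by positivity)).sqrt
  rw [show (1 : ℝ) / √Real.pi = √(1 / 2 / (Real.pi / 2)) by
    rw [div_div_div_cancel_right₀ (by norm_num), Real.sqrt_div zero_le_one, Real.sqrt_one]]
  exact h2

theorem count_univ_eq_centralBinom (n : ℕ) :
    (count Set.univ n : ℝ) = 2 ^ (n + 1) * n.centralBinom / (n + 1) := by
  rw [count_univ_eq_catalan, ← succ_mul_catalan_eq_centralBinom]
  have : (n : ℝ) + 1 ≠ 0 := by positivity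
  push_cast
  field_simp

theorem Gamma_neg_one_half : Real.Gamma (-(1 / 2)) = -2 * √Real.pi := by
  have h := Real.Gamma_add_one (s := -(1 / 2)) (by norm_num)
  rw [show -(1 / 2 : ℝ) + 1 = 1 / 2 by norm_num, Real.Gamma_one_half_eq] at h
  linarith

theorem isEquivalent_count_univ :
    (fun n : ℕ => (count Set.univ n : ℝ)) ~[atTop]
      fun n : ℕ => (8 : ℝ) ^ n * ((-4) * (n : ℝ) ^ (-(3 / 2) : ℝ) / Real.Gamma (-(1 / 2))) := by
  have hpi : 0 < √Real.pi := Real.sqrt_pos.2 Real.pi_pos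
  rw [isEquivalent_iff_tendsto_one]
  · have h := (tendsto_centralBinom_mul_sqrt.mul (tendsto_natCast_div_add_atTop (1 : ℝ))).mul_const
      √Real.pi
    rw [mul_one, one_div, inv_mul_cancel₀ hpi.ne'] at h
    refine h.congr' ?_
    filter_upwards [eventually_gt_atTop 0] with n hn
    have hn' : (0 : ℝ) < n := Nat.cast_pos.2 hn
    have hs : 0 < √(n : ℝ) := Real.sqrt_pos.2 hn'
    have hp : (n : ℝ) ^ (-(3 / 2) : ℝ) = (n * √(n : ℝ))⁻¹ := by
      rw [Real.rpow_neg hn'.le, Real.sqrt_eq_rpow, ← Real.rpow_one_add' hn'.le (by norm_num)]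
      norm_num
    have h8 : (8 : ℝ) ^ n = 2 ^ n * 4 ^ n := by rw [← mul_pow]; norm_num
    simp only [Pi.div_apply]
    rw [count_univ_eq_centralBinom, Gamma_neg_one_half, hp, h8]
    field_simp
    ring
  · filter_upwards [eventually_gt_atTop 0] with n hn
    have hn' : (0 : ℝ) < n := Nat.cast_pos.2 hn
    rw [Gamma_neg_one_half]
    have : (0 : ℝ) < (n : ℝ) ^ (-(3 / 2) : ℝ) := Real.rpow_pos_of_pos hn' _
    have h2 : -2 * √Real.pi ≠ 0 := by linarith
    positivity

theorem count_univ_succ_mul (n : ℕ) :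
    (count Set.univ (n + 1) : ℝ) * (n + 2) = 4 * (2 * n + 1) * count Set.univ n := by
  rw [count_univ_eq_centralBinom, count_univ_eq_centralBinom]
  have h : ((n : ℝ) + 1) * (n + 1).centralBinom = 2 * (2 * n + 1) * n.centralBinom := by
    exact_mod_cast Nat.succ_mul_centralBinom_succ n
  have h1 : (n : ℝ) + 1 ≠ 0 := by positivity
  have h2 : (n : ℝ) + 2 ≠ 0 := by positivity
  push_cast
  rw [show (n : ℝ) + 1 + 1 = n + 2 by ring]
  field_simp
  linear_combination (2 : ℝ) ^ (n + 1 + 1) * h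

theorem tendsto_count_univ_div_succ :
    Tendsto (fun n : ℕ => (count Set.univ n : ℝ) / count Set.univ (n + 1)) atTop (𝓝 (1 / 8)) := by
  have h1 : Tendsto (fun n : ℕ => ((n : ℝ) / (n + 1 / 2)) * (1 / 8) + (1 / 4) * ((n : ℝ) + 1 / 2)⁻¹)
      atTop (𝓝 (1 * (1 / 8) + (1 / 4) * 0)) := by
    refine ((tendsto_natCast_div_add_atTop (1 / 2 : ℝ)).mul_const _).add (Tendsto.const_mul _ ?_)
    exact tendsto_inv_atTop_zero.comp
      (tendsto_atTop_add_const_right _ _ tendsto_natCast_atTop_atTop)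
  norm_num only at h1
  refine h1.congr fun n => ?_
  have h := count_univ_succ_mul n
  have hp : (0 : ℝ) < count Set.univ (n + 1) := Nat.cast_pos.2 (count_univ_pos _)
  rw [eq_div_iff hp.ne']
  have h3 : (n : ℝ) + 1 / 2 ≠ 0 := by positivity
  field_simp
  linear_combination 8 * h

theorem tendsto_count_univ_div (i : ℕ) :
    Tendsto (fun n : ℕ => (count Set.univ (n - i) : ℝ) / count Set.univ n) atTop
      (𝓝 ((1 / 8) ^ i)) := by
  induction i with
  | zero =>
    refine tendsto_const_nhds.congr fun n => ?_
    have hp : (0 : ℝ) < count Set.univ n := Nat.cast_pos.2 (count_univ_pos _)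
    simp [hp.ne']
  | succ i ih =>
    have h := (tendsto_count_univ_div_succ.comp (tendsto_sub_atTop_nat (i + 1))).mul ih
    rw [← pow_succ'] at h
    refine h.congr' ?_
    filter_upwards [eventually_ge_atTop (i + 1)] with n hn
    have hp : (0 : ℝ) < count Set.univ (n - i) := Nat.cast_pos.2 (count_univ_pos _)
    simp only [Function.comp_apply]
    rw [show n - (i + 1) + 1 = n - i by omega]
    field_simp

/-- The defect of the partial sums of `∑ c_i 8^{-(i+1)} = 1/2` has a closed form. -/
theorem sum_count_univ_div (m : ℕ) :
    ∑ i ∈ Finset.range m, (count Set.univ i : ℝ) * (1 / 8) ^ (i + 1)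
      = 1 / 2 - (m.centralBinom : ℝ) / 4 ^ m / 2 := by
  induction m with
  | zero => simp
  | succ m ih =>
    rw [Finset.sum_range_succ, ih, count_univ_eq_centralBinom]
    have h : ((m : ℝ) + 1) * (m + 1).centralBinom = 2 * (2 * m + 1) * m.centralBinom := by
      exact_mod_cast Nat.succ_mul_centralBinom_succ m
    have h1 : (m : ℝ) + 1 ≠ 0 := by positivity
    have h8 : (8 : ℝ) ^ m = 2 ^ m * 4 ^ m := by rw [← mul_pow]; norm_num
    have h2 : ((m + 1).centralBinom : ℝ) = 2 * (2 * m + 1) * m.centralBinom / (m + 1) := by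
      rw [eq_div_iff h1]; linarith
    rw [h2, one_div_pow, pow_succ 8, h8]
    field_simp
    ring

theorem tendsto_centralBinom_div_four_pow :
    Tendsto (fun n : ℕ => (n.centralBinom : ℝ) / 4 ^ n) atTop (𝓝 0) := by
  have h := tendsto_centralBinom_mul_sqrt.mul
    (tendsto_inv_atTop_zero.comp (Real.tendsto_sqrt_atTop.comp tendsto_natCast_atTop_atTop))
  rw [mul_zero] at h
  refine h.congr' ?_
  filter_upwards [eventually_gt_atTop 0] with n hn
  have hs : 0 < √(n : ℝ) := Real.sqrt_pos.2 (Nat.cast_pos.2 hn)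
  simp only [Function.comp_apply]
  field_simp

/-! ### Sequences that stay near a limit -/

/-- The sequence `f` is eventually in every interval of radius larger than `δ` around a fixed
center, so that its upper and lower limits differ by at most `2 * δ`. -/
def NearLim (f : ℕ → ℝ) (δ : ℝ) : Prop :=
  ∃ L : ℝ, ∀ δ' > δ, ∀ᶠ n in atTop, |f n - L| ≤ δ'

namespace NearLim

variable {f g : ℕ → ℝ} {δ ε : ℝ}

theorem of_tendsto {L : ℝ} (h : Tendsto f atTop (𝓝 L)) : NearLim f 0 :=
  ⟨L, fun δ' hδ' => (Metric.tendsto_nhds.1 h δ' hδ').mono fun _ hn => le_of_lt hn⟩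

theorem mono (h : NearLim f δ) (hle : δ ≤ ε) : NearLim f ε := by
  obtain ⟨L, hL⟩ := h
  exact ⟨L, fun δ' hδ' => hL δ' (lt_of_le_of_lt hle hδ')⟩

/-- Perturbing a sequence by an error whose upper limit is at most `τ` costs `τ`. -/
theorem of_abs_sub_le {e : ℕ → ℝ} {τ : ℝ} (hg : NearLim g δ) (he : Tendsto e atTop (𝓝 τ))
    (hfg : ∀ᶠ n in atTop, |f n - g n| ≤ e n) : NearLim f (δ + τ) := by
  obtain ⟨L, hL⟩ := hg
  refine ⟨L, fun δ' hδ' => ?_⟩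
  have hη : 0 < (δ' - (δ + τ)) / 2 := by linarith
  filter_upwards [hL (δ + (δ' - (δ + τ)) / 2) (by linarith),
    he.eventually_lt_const (show τ < τ + (δ' - (δ + τ)) / 2 by linarith), hfg] with n h1 h2 h3
  have := abs_sub_le (f n) (g n) L
  linarith

theorem add (hf : NearLim f δ) (hg : NearLim g ε) : NearLim (fun n => f n + g n) (δ + ε) := by
  obtain ⟨L, hL⟩ := hf
  obtain ⟨L', hL'⟩ := hg
  refine ⟨L + L', fun δ' hδ' => ?_⟩
  filter_upwards [hL (δ + (δ' - (δ + ε)) / 2) (by linarith),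
    hL' (ε + (δ' - (δ + ε)) / 2) (by linarith)] with n h1 h2
  rw [add_sub_add_comm]
  have := abs_add_le (f n - L) (g n - L')
  linarith

theorem sum {ι : Type*} {s : Finset ι} {F : ι → ℕ → ℝ} {d : ι → ℝ}
    (h : ∀ i ∈ s, NearLim (F i) (d i)) : NearLim (fun n => ∑ i ∈ s, F i n) (∑ i ∈ s, d i) := by
  classical
  induction s using Finset.induction_on with
  | empty => simpa using of_tendsto (tendsto_const_nhds (x := (0 : ℝ)))
  | insert a s ha ih =>
    simp only [Finset.sum_insert ha]
    exact (h a (Finset.mem_insert_self a s)).add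
      (ih fun i hi => h i (Finset.mem_insert_of_mem hi))

theorem mul_tendsto {γ : ℝ} (hf : NearLim f δ) (hf1 : ∀ n, |f n| ≤ 1)
    (hg : Tendsto g atTop (𝓝 γ)) (hγ : 0 ≤ γ) : NearLim (fun n => f n * g n) (γ * δ) := by
  obtain ⟨L, hL⟩ := hf
  refine ⟨γ * L, fun e he => ?_⟩
  have hη : 0 < (e - γ * δ) / 2 := by linarith
  filter_upwards [hL (δ + (e - γ * δ) / 2 / (γ + 1)) (by
      have : 0 < (e - γ * δ) / 2 / (γ + 1) := by positivity
      linarith), Metric.tendsto_nhds.1 hg _ hη] with n h1 h2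
  rw [Real.dist_eq] at h2
  have h3 : f n * g n - γ * L = f n * (g n - γ) + γ * (f n - L) := by ring
  have h4 : |f n * (g n - γ)| ≤ (e - γ * δ) / 2 := by
    rw [abs_mul]
    nlinarith [hf1 n, abs_nonneg (g n - γ)]
  have h5 : |γ * (f n - L)| ≤ γ * δ + (e - γ * δ) / 2 := by
    rw [abs_mul, abs_of_nonneg hγ]
    refine (mul_le_mul_of_nonneg_left h1 hγ).trans ?_
    rw [mul_add]
    gcongr
    rw [mul_div_assoc', div_le_iff₀ (by linarith)]
    nlinarith
  rw [h3]
  exact (abs_add_le _ _).trans (by linarith)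

theorem comp_sub (hf : NearLim f δ) (i : ℕ) : NearLim (fun n => f (n - i)) δ := by
  obtain ⟨L, hL⟩ := hf
  exact ⟨L, fun δ' hδ' => (tendsto_sub_atTop_nat i).eventually (hL δ' hδ')⟩

theorem of_comp_succ (hf : NearLim (fun n => f (n + 1)) δ) : NearLim f δ := by
  refine (hf.comp_sub 1).imp fun L hL δ' hδ' => ?_
  filter_upwards [hL δ' hδ', eventually_ge_atTop 1] with n hn h1
  rwa [Nat.sub_add_cancel h1] at hn

theorem exists_tendsto (h : ∀ δ > 0, NearLim f δ) : ∃ L, Tendsto f atTop (𝓝 L) := by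
  refine cauchySeq_tendsto_of_complete (Metric.cauchySeq_iff'.2 fun ε hε => ?_)
  obtain ⟨L, hL⟩ := h (ε / 4) (by positivity)
  obtain ⟨n₀, hn₀⟩ := eventually_atTop.1 (hL (ε / 3) (by linarith))
  refine ⟨n₀, fun n hn => ?_⟩
  rw [Real.dist_eq]
  have h1 := hn₀ n hn
  have h2 := hn₀ n₀ le_rfl
  have h3 := abs_sub_le (f n) L (f n₀)
  rw [abs_sub_comm L] at h3
  linarith

end NearLim

/-! ### Saturated classes have a density -/

/-- The proportion of the terms of size `n` that lie in `A`. -/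
noncomputable def ratio (A : Set SK) (n : ℕ) : ℝ := count A n / count Set.univ n

theorem ratio_nonneg (A : Set SK) (n : ℕ) : 0 ≤ ratio A n := by unfold ratio; positivity

theorem abs_ratio_le_one (A : Set SK) (n : ℕ) : |ratio A n| ≤ 1 := by
  rw [abs_of_nonneg (ratio_nonneg A n)]
  exact div_le_one_of_le₀ (Nat.cast_le.2 (count_mono (Set.subset_univ A) n)) (Nat.cast_nonneg _)

/-- Cutting off `m` terms at both ends of a sum is monotone in its nonnegative terms. -/
theorem abs_sum_range_sub_ends_le {p q : ℕ → ℝ} (hq : ∀ i, 0 ≤ q i) (hqp : ∀ i, q i ≤ p i)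
    {m n : ℕ} (h : 2 * m ≤ n + 1) :
    |∑ i ∈ Finset.range (n + 1), q i
        - (∑ i ∈ Finset.range m, q i + ∑ i ∈ Finset.range m, q (n - i))|
      ≤ ∑ i ∈ Finset.range (n + 1), p i
        - (∑ i ∈ Finset.range m, p i + ∑ i ∈ Finset.range m, p (n - i)) := by
  have key : ∀ f : ℕ → ℝ, ∑ i ∈ Finset.range (n + 1), f i
      - (∑ i ∈ Finset.range m, f i + ∑ i ∈ Finset.range m, f (n - i))
      = ∑ i ∈ Finset.Ico m (n + 1 - m), f i := by
    intro f
    have h1 : ∑ i ∈ Finset.range m, f (n - i) = ∑ i ∈ Finset.Ico (n + 1 - m) (n + 1), f i := by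
      rw [Finset.range_eq_Ico, Finset.sum_Ico_reflect f 0 (by omega : m ≤ n + 1), Nat.sub_zero]
    rw [h1, Finset.range_eq_Ico, Finset.range_eq_Ico,
      ← Finset.sum_Ico_consecutive f (Nat.zero_le m) (by omega : m ≤ n + 1),
      ← Finset.sum_Ico_consecutive f (by omega : m ≤ n + 1 - m) (by omega : n + 1 - m ≤ n + 1)]
    ring
  rw [key, key, abs_of_nonneg (Finset.sum_nonneg fun i _ => hq i)]
  exact Finset.sum_le_sum fun i _ => hqp i

/-- A term of size `n + 1` in `A` is an application with a small function part, a small argument,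
or two large parts; the last case is bounded by the number of all such terms. -/
theorem abs_count_succ_sub_le (A : Set SK) {m n : ℕ} (h : 2 * m ≤ n + 1) :
    |(count A (n + 1) : ℝ)
        - (∑ i ∈ Finset.range m, ∑ M ∈ ofSize i, (count (argSection A M) (n - i) : ℝ)
          + ∑ i ∈ Finset.range m, ∑ N ∈ ofSize i, (count (funSection A N) (n - i) : ℝ))|
      ≤ count Set.univ (n + 1)
        - 2 * ∑ i ∈ Finset.range m, (count Set.univ i : ℝ) * count Set.univ (n - i) := by
  have hrefl : ∀ B : Set SK, ∑ i ∈ Finset.range m, (countSplit B (n - i) (n - (n - i)) : ℝ)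
      = ∑ i ∈ Finset.range m, (countSplit B (n - i) i : ℝ) := fun B =>
    Finset.sum_congr rfl fun i hi => by
      rw [Nat.sub_sub_self (by have := Finset.mem_range.1 hi; omega)]
  have hcount : ∀ B : Set SK, ∑ i ∈ Finset.range (n + 1), (countSplit B i (n - i) : ℝ)
      = count B (n + 1) := fun B => by rw [count_succ, Nat.cast_sum]
  have key := abs_sum_range_sub_ends_le (q := fun i => (countSplit A i (n - i) : ℝ))
    (p := fun i => (countSplit Set.univ i (n - i) : ℝ)) (fun i => Nat.cast_nonneg _)
    (fun i => Nat.cast_le.2 (countSplit_le A i (n - i))) h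
  simp only [hrefl, hcount] at key
  convert key using 3
  · simp only [countSplit_eq_sum_argSection A, ← Nat.cast_sum]
    simp only [← countSplit_eq_sum_argSection, ← countSplit_eq_sum_funSection]
  · simp only [countSplit_univ, Nat.cast_mul, two_mul]
    simp only [mul_comm]

/-- The oscillation of the proportion of `A` is controlled by those of the sections of `A`: in a
large random term, one of the two parts is small, and it is the term `M` with probability
`8^{-(|M| + 1)}`. -/
theorem nearLim_ratio_of_sections (A : Set SK) {d d' : SK → ℝ}
    (hd : ∀ M, NearLim (ratio (argSection A M)) (d M))
    (hd' : ∀ N, NearLim (ratio (funSection A N)) (d' N)) (m : ℕ) :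
    NearLim (ratio A)
      (∑ i ∈ Finset.range m, ∑ M ∈ ofSize i, (1 / 8) ^ (i + 1) * d M
        + ∑ i ∈ Finset.range m, ∑ N ∈ ofSize i, (1 / 8) ^ (i + 1) * d' N
        + (m.centralBinom : ℝ) / 4 ^ m) := by
  have hc : ∀ n, (0 : ℝ) < count Set.univ n := fun n => Nat.cast_pos.2 (count_univ_pos n)
  have hlim : ∀ i, Tendsto (fun n : ℕ => (count Set.univ (n - i) : ℝ) / count Set.univ (n + 1))
      atTop (𝓝 ((1 / 8) ^ (i + 1))) := fun i =>
    ((tendsto_count_univ_div (i + 1)).comp (tendsto_add_atTop_nat 1)).congr fun n => by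
      simp only [Function.comp_apply, Nat.add_sub_add_right]
  have hsec : ∀ (B : Set SK) (e : ℝ) (i : ℕ), NearLim (ratio B) e →
      NearLim (fun n => (count B (n - i) : ℝ) / count Set.univ (n + 1)) ((1 / 8) ^ (i + 1) * e) := by
    intro B e i hB
    have h := (hB.comp_sub i).mul_tendsto (fun n => abs_ratio_le_one B _) (hlim i) (by positivity)
    refine (funext fun n => ?_ : _ = fun n => (count B (n - i) : ℝ) / count Set.univ (n + 1)) ▸ h
    rw [ratio, div_mul_div_cancel₀ (hc _).ne']
  have hmid : Tendsto (fun n => ((count Set.univ (n + 1) : ℝ)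
      - 2 * ∑ i ∈ Finset.range m, (count Set.univ i : ℝ) * count Set.univ (n - i))
        / count Set.univ (n + 1)) atTop (𝓝 ((m.centralBinom : ℝ) / 4 ^ m)) := by
    have h := (tendsto_finsetSum (Finset.range m) fun i _ =>
      (hlim i).const_mul (count Set.univ i : ℝ)).const_mul 2
    rw [sum_count_univ_div] at h
    have h := h.const_sub 1
    rw [show (1 : ℝ) - 2 * (1 / 2 - (m.centralBinom : ℝ) / 4 ^ m / 2) = m.centralBinom / 4 ^ m by
      ring] at h
    refine h.congr fun n => ?_
    rw [sub_div, div_self (hc _).ne', mul_div_assoc, Finset.sum_div]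
    simp only [mul_div_assoc]
  refine NearLim.of_comp_succ (NearLim.of_abs_sub_le (NearLim.add
    (NearLim.sum fun i _ => NearLim.sum fun M _ => hsec _ _ i (hd M))
    (NearLim.sum fun i _ => NearLim.sum fun N _ => hsec _ _ i (hd' N))) hmid ?_)
  filter_upwards [eventually_ge_atTop (2 * m)] with n hn
  simp only [← Finset.sum_div, ← add_div, ratio]
  rw [← sub_div, abs_div, abs_of_pos (hc (n + 1))]
  exact div_le_div_of_nonneg_right (abs_count_succ_sub_le A (by omega)) (hc _).le

/-- Every saturated class has a density. By induction on the level, the sections at the functions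
`K x` contribute no oscillation, so that the oscillations of all classes saturated at this level
are at most a constant factor less than one times the largest of them, hence zero. -/
theorem Saturated.exists_tendsto_ratio {j : ℕ} {A : Set SK} (hA : Saturated j A) :
    ∃ L, Tendsto (ratio A) atTop (𝓝 L) := by
  classical
  induction j generalizing A with
  | zero =>
    rcases hA.eq_empty_or_univ with rfl | rfl
    · exact ⟨0, tendsto_const_nhds.congr fun n => by simp [ratio, count]⟩
    · refine ⟨1, tendsto_const_nhds.congr fun n => ?_⟩
      have : (count Set.univ n : ℝ) ≠ 0 := Nat.cast_ne_zero.2 (count_univ_pos n).ne'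
      rw [ratio, div_self this]
  | succ j ih =>
    have key : ∀ (i : ℕ) (A : Set SK), Saturated (j + 1) A →
        NearLim (ratio A) ((127 / 128) ^ i) := by
      intro i
      induction i with
      | zero =>
        refine fun A _ => ⟨0, fun δ' hδ' => Eventually.of_forall fun n => ?_⟩
        rw [pow_zero] at hδ'
        rw [sub_zero]
        exact (abs_ratio_le_one A n).trans hδ'.le
      | succ i ihi =>
        intro A hA
        set δ : ℝ := (127 / 128) ^ i with hδ
        have hδ0 : 0 < δ := by positivity
        obtain ⟨m, hm, hm2⟩ := ((tendsto_centralBinom_div_four_pow.eventually_lt_const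
          (show (0 : ℝ) < δ / 128 by positivity)).and (eventually_ge_atTop 2)).exists
        -- The single function part `K S`, of probability `8^{-2}`, already gives a contraction.
        have hd : ∀ M, NearLim (ratio (argSection A M)) (δ - if M = app K S then δ else 0) := by
          intro M
          split_ifs with hM
          · obtain ⟨L, hL⟩ := ih (hM ▸ saturated_argSection_K hA S)
            rw [sub_self]
            exact NearLim.of_tendsto hL
          · rw [sub_zero]
            exact ihi _ (saturated_argSection hA M)
        refine (nearLim_ratio_of_sections A hd (fun N => ihi _ (saturated_funSection hA N))
          m).mono ?_
        have hsum : ∑ i ∈ Finset.range m, ∑ M ∈ ofSize i, (1 / 8 : ℝ) ^ (i + 1) * δ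
            = (1 / 2 - (m.centralBinom : ℝ) / 4 ^ m / 2) * δ := by
          rw [← sum_count_univ_div, Finset.sum_mul]
          refine Finset.sum_congr rfl fun i _ => ?_
          rw [Finset.sum_const, card_ofSize, nsmul_eq_mul, mul_assoc]
        have hKS : ∑ i ∈ Finset.range m, ∑ M ∈ ofSize i,
            (1 / 8 : ℝ) ^ (i + 1) * (if M = app K S then δ else 0) = δ / 64 := by
          simp only [mul_ite, mul_zero, Finset.sum_ite_eq', mem_ofSize, size, Finset.sum_ite_eq,
            Finset.mem_range]
          rw [if_pos (by omega)]
          ring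
        simp only [mul_sub, Finset.sum_sub_distrib, hsum, hKS]
        rw [pow_succ, ← hδ]
        have : 0 ≤ (m.centralBinom : ℝ) / 4 ^ m * δ := by positivity
        linarith
    refine NearLim.exists_tendsto fun δ hδ => ?_
    obtain ⟨i, hi⟩ := exists_pow_lt_of_lt_one hδ (by norm_num : (127 / 128 : ℝ) < 1)
    exact (key i A hA).mono hi.le

/-! ### Positivity of the densities -/

/-- For every `P`, the term `K (… (K (K S P) S) …) S` with `k + 1` nested redexes normalizes
in `k + 1` steps, since `P` is erased; this accounts for a positive proportion of all terms. -/
theorem count_univ_le_count_R (k n : ℕ) :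
    count Set.univ n ≤ count (R (k + 1)) (n + 2 * (k + 1)) := by
  induction k with
  | zero =>
    refine Set.ncard_le_ncard_of_injOn (fun P => app (app K S) P) ?_ ?_ (finite_count _ _)
    · rintro P ⟨-, hP⟩
      refine ⟨⟨S, .root (.k _ _), ?_⟩, by simp only [size]; omega⟩
      rintro ⟨Q, hQ⟩
      cases hQ with
      | root h => cases h
    · intro P _ Q _ h
      exact (SK.app.inj h).2
  | succ k ih =>
    refine ih.trans (Set.ncard_le_ncard_of_injOn (fun P => app (app K P) S) ?_ ?_
      (finite_count _ _))
    · rintro P ⟨hk, hP⟩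
      exact ⟨⟨P, .root (.k _ _), hk⟩, by simp only [size]; omega⟩
    · intro P _ Q _ h
      exact (SK.app.inj (SK.app.inj h).1).2

theorem exists_hasDensity_R (k : ℕ) : ∃ d : ℝ, 0 < d ∧ HasDensity (R (k + 1)) d := by
  obtain ⟨d, hd⟩ := (saturated_R (k + 1)).exists_tendsto_ratio
  refine ⟨d, lt_of_lt_of_le (by positivity : (0 : ℝ) < (1 / 8) ^ (2 * (k + 1))) ?_, hd⟩
  refine le_of_tendsto_of_tendsto (tendsto_count_univ_div (2 * (k + 1))) hd ?_
  filter_upwards [eventually_ge_atTop (2 * (k + 1))] with n hn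
  refine div_le_div_of_nonneg_right (Nat.cast_le.2 ?_) (Nat.cast_nonneg _)
  have h := count_univ_le_count_R k (n - 2 * (k + 1))
  rwa [Nat.sub_add_cancel hn] at h

end SK

theorem mainTheorem1 :
    ((fun n : ℕ => PowerSeries.coeff n (SK.genFun Set.univ)) ~[atTop]
      fun n : ℕ => (8 : ℝ) ^ n * ((-4) * (n : ℝ) ^ (-(3 / 2) : ℝ) / Real.Gamma (-(1 / 2)))) ∧
    ∀ k : ℕ, 1 ≤ k → ∃ C : ℝ, C < 0 ∧
      ((fun n : ℕ => PowerSeries.coeff n (SK.genFun (SK.R k))) ~[atTop]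
        fun n : ℕ => (8 : ℝ) ^ n * (C * (n : ℝ) ^ (-(3 / 2) : ℝ) / Real.Gamma (-(1 / 2)))) ∧
      SK.HasDensity (SK.R k) (C / (-4)) := by
  simp only [SK.genFun, PowerSeries.coeff_mk]
  refine ⟨SK.isEquivalent_count_univ, fun k hk => ?_⟩
  obtain ⟨k, rfl⟩ := Nat.exists_eq_add_of_le' hk
  obtain ⟨d, hd, hlim⟩ := SK.exists_hasDensity_R k
  refine ⟨-4 * d, by linarith, ?_, by rwa [mul_div_cancel_left₀ _ (by norm_num)]⟩
  have hd' : (fun n => (SK.count (SK.R (k + 1)) n : ℝ) / SK.count Set.univ n) ~[atTop]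
      fun _ => d := (isEquivalent_const_iff_tendsto hd.ne').2 hlim
  refine ((hd'.mul SK.isEquivalent_count_univ).congr_left ?_).congr_right ?_
  · refine Eventually.of_forall fun n => ?_
    have : (SK.count Set.univ n : ℝ) ≠ 0 := Nat.cast_ne_zero.2 (SK.count_univ_pos n).ne'
    simp only [Pi.mul_apply]
    field_simp
  · refine Eventually.of_forall fun n => ?_
    simp only [Pi.mul_apply]
    ring
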